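/- **Setting.** For every $k\ge 1$ let $f_k:\{0,1,2,\dots\}\to[0,\infty)$ satisfy $f_k(0)=0$ and $f_k(i)>0$ for all $i\ge 1$ (no other assumption is made on the $f_k$), and let $(s_n)_{n\ge1}$ be a sequence of real numbers, possibly random, with values in $[0,1]$. A *generalized attachment model* $\mathrm{GAM}(\{f_k\},\{s_n\})$ is a family of random variables $A_j(n)\in\{0,1,2,\dots\}$, $j,n\ge1$, on a probability space ($A_j(n)$ is the cardinality of the $j$th group at time $n$) such that, almost surely, $A_1(1)=1$ and $A_j(1)=0$ for $j\ge2$ and, with $L_n=\max\{j\ge1: A_j(n)\ge1\}$ denoting the number of groups at time $n$, for every $n\ge1$ exactly one of the groups $1,\dots,L_n+1$ gains exactly one member between times $n$ and $n+1$ while all other cardinalities are unchanged, with conditional probabilities, given $s_n$ and the current state $(A_j(n))_{j\ge1}$, $$\mathbb P\bigl(A_k(n+1)=A_k(n)+1 \,\big|\, s_n,(A_j(n))_{j}\bigr)=(1-s_n)\,\frac{f_k(A_k(n))}{\sum_{l=1}^{L_n}f_l(A_l(n))}\qquad (1\le k\le L_n),$$ $$\mathbb P\bigl(A_{L_n+1}(n+1)=1\,\big|\,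 s_n,(A_j(n))_{j}\bigr)=s_n .$$ Group $j$ is *created* if $A_j(n)\ge1$ for some $n$; it *stays finite* if $\sup_n A_j(n)<\infty$. Since which groups are created is in general random, the conditions and conclusions below are understood outcome by outcome. **Theorem 1.5.** Consider a $\mathrm{GAM}(\{f_j\},\{s_n\})$ and suppose that there is a constant $p<1$ such that, almost surely, $s_n\le p$ for all $n\ge1$. (i) Almost surely, if $\sum_{n=1}^\infty 1/f_j(n)<\infty$ for at least one created group $j$, then there is at most one group whose cardinality tends to infinity, and all the other created groups stay finite. (ii) Almost surely, if $\sum_{n=1}^\infty 1/f_j(n)=\infty$ for all created groups $j$, then either the cardinality of every created group tends to infinity, or every created group stays finite. Consequently there are at most three phases: almost surely, either the cardinality of every created group tends to infinity, or every created group stays finite, or there is exactly one group whose cardinality tends to infinity and all the other created groups stay finite. -/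

import Mathlib

open MeasureTheory ProbabilityTheory Filter

namespace GAM

/-- The number `L_n = max {j ≥ 1 : A_j(n) ≥ 1}` of groups present at time `n`.
Here `A j n ω` is the cardinality of group `j` at time `n`; groups and times are numbered
from `1`. -/
noncomputable def numGroups {Ω : Type*} (A : ℕ → ℕ → Ω → ℕ) (n : ℕ) (ω : Ω) : ℕ :=
  sSup {j : ℕ | 1 ≤ j ∧ 1 ≤ A j n ω}

/-- The information on which the step from time `n` to time `n + 1` is conditioned: the
σ-algebra generated by the current cardinalities `A_j(n)`, `j ≥ 1` (hence also by `L_n`), and by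
the current, possibly random, value `s_n`. If `s_n` is deterministic, or a function of the
current state, this is just the σ-algebra of the current state. If the transition
probabilities below hold given some finer σ-algebra (the whole past, or the past together with the
whole sequence `s`), then by the tower property they hold given this one. -/
abbrev stateSigma {Ω : Type*} (s : ℕ → Ω → ℝ) (A : ℕ → ℕ → Ω → ℕ) (n : ℕ) :
    MeasurableSpace Ω :=
  (⨆ (j : ℕ) (_ : 1 ≤ j), MeasurableSpace.comap (A j n) ⊤) ⊔
    MeasurableSpace.comap (s n) inferInstance

/-- The total weight `∑_{l = 1}^{L_n} f_l(A_l(n))` of the groups present at time `n`. -/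
noncomputable def totalWeight {Ω : Type*} (f : ℕ → ℕ → ℝ) (A : ℕ → ℕ → Ω → ℕ)
    (n : ℕ) (ω : Ω) : ℝ :=
  ∑ l ∈ Finset.Icc 1 (numGroups A n ω), f l (A l n ω)

/-- `A` is a generalized attachment model with reinforcement functions `f_k`, `k ≥ 1`, and
(possibly random) probabilities `s_n`, `n ≥ 1`, of creating a new group. -/
structure IsGAM {Ω : Type*} [MeasurableSpace Ω] (μ : Measure Ω)
    (f : ℕ → ℕ → ℝ) (s : ℕ → Ω → ℝ) (A : ℕ → ℕ → Ω → ℕ) : Prop where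
  f_zero : ∀ k, 1 ≤ k → f k 0 = 0
  f_pos : ∀ k i, 1 ≤ k → 1 ≤ i → 0 < f k i
  measurable_s : ∀ n, 1 ≤ n → Measurable (s n)
  s_mem : ∀ n, 1 ≤ n → ∀ᵐ ω ∂μ, s n ω ∈ Set.Icc (0 : ℝ) 1
  measurable_A : ∀ j n, 1 ≤ j → 1 ≤ n → Measurable (A j n)
  /-- At time `1` there is one group, with one member. -/
  init : ∀ᵐ ω ∂μ, A 1 1 ω = 1 ∧ ∀ j, 2 ≤ j → A j 1 ω = 0
  /-- At each step exactly one of the groups `1, …, L_n + 1` gains one member. -/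
  step : ∀ n, 1 ≤ n → ∀ᵐ ω ∂μ, ∃ k, 1 ≤ k ∧ k ≤ numGroups A n ω + 1 ∧
    A k (n + 1) ω = A k n ω + 1 ∧ ∀ j, 1 ≤ j → j ≠ k → A j (n + 1) ω = A j n ω
  /-- The conditional probability that the new member joins the existing group `k`. -/
  prob_join : ∀ n k, 1 ≤ n → 1 ≤ k → ∀ᵐ ω ∂μ, k ≤ numGroups A n ω →
    (μ⟦{ω' | A k (n + 1) ω' = A k n ω' + 1} | stateSigma s A n⟧) ω =
      (1 - s n ω) * (f k (A k n ω) / totalWeight f A n ω)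
  /-- The conditional probability that the new member founds the group `L_n + 1`. -/
  prob_new : ∀ n, 1 ≤ n → ∀ᵐ ω ∂μ,
    (μ⟦{ω' | A (numGroups A n ω' + 1) (n + 1) ω' = 1} | stateSigma s A n⟧) ω = s n ω

/-- On the outcome `ω`, group `j` is created at some time. -/
def Created {Ω : Type*} (A : ℕ → ℕ → Ω → ℕ) (ω : Ω) (j : ℕ) : Prop :=
  1 ≤ j ∧ ∃ n, 1 ≤ n ∧ 1 ≤ A j n ω

/-- On the outcome `ω`, the cardinality of group `j` tends to infinity. -/
def GrowsToInfinity {Ω : Type*} (A : ℕ → ℕ → Ω → ℕ) (ω : Ω) (j : ℕ) : Prop :=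
  Tendsto (fun n => A j n ω) atTop atTop

/-- On the outcome `ω`, group `j` stays finite. -/
def StaysFinite {Ω : Type*} (A : ℕ → ℕ → Ω → ℕ) (ω : Ω) (j : ℕ) : Prop :=
  ∃ m, ∀ n, 1 ≤ n → A j n ω ≤ m

end GAM

/-! Two groups are compared at a time. While both are nonempty, with sizes `a` and `b`, the common
factor `(1 - s_n) / totalWeight` cancels, and the chances of joining them are in the ratio `f a : g
b`. This identity in its one-step form (`IsGAM.balance`) is the only probabilistic input;
`IsPairUrn` records it.

Summed over time, it says that the `X`-jumps out of `(a, b)`, weighted by `1 / f a`, have the same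
mass as the `Y`-jumps weighted by `1 / g b` (`crossing_balance`), while each level is left at most
once. Hence if `∑ 1 / f` diverges, `X` cannot grow beside a stuck nonempty `Y`
(`tendsto_of_not_summable`); if `∑ 1 / f` converges and `∑ 1 / g` diverges, both cannot grow.

If both series converge, the heuristic is Rubin's: with independent exponential clocks of rates `f
a` and `g b`, both groups grow only if two explosion times coincide, which has probability zero. The
proof uses only the characteristic function `H(a, b) = u a * v b` of the difference of the remaining
times, at frequency `θ`. It is harmonic for the pair, tends to `1` where both grow, and vanishes at
each fixed positive state as `θ → ∞`; comparing means gives probability zero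
(`not_both_tendsto_of_summable`). The trichotomy is then logic on each outcome. -/

namespace GAM

/-! ### Integer paths with steps zero or one -/

section Paths

lemma monotone_of_unit_steps {u : ℕ → ℕ} (hu : ∀ n, u (n + 1) = u n ∨ u (n + 1) = u n + 1) :
    Monotone u :=
  monotone_nat_of_le_succ fun n => by rcases hu n with h | h <;> omega

lemma exists_crossing_time {u : ℕ → ℕ} (hu : ∀ n, u (n + 1) = u n ∨ u (n + 1) = u n + 1)
    (hlim : Tendsto u atTop atTop) {m a : ℕ} (hm : u m ≤ a) :
    ∃ n, m ≤ n ∧ u n = a ∧ u (n + 1) = a + 1 := by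
  by_contra! hcon
  have hle : ∀ n, m ≤ n → u n ≤ a := by
    intro n hn
    induction n, hn using Nat.le_induction with
    | base => exact hm
    | succ n hn ih =>
      rcases hu n with h | h
      · omega
      · have := hcon n hn
        omega
  obtain ⟨n, hn, hn'⟩ := ((hlim.eventually_gt_atTop a).and (eventually_ge_atTop m)).exists
  exact absurd (hle n hn') (by omega)

lemma crossing_time_unique {u : ℕ → ℕ} (hu : Monotone u) {a m n : ℕ}
    (hm : u m = a) (hm' : u (m + 1) = a + 1) (hn : u n = a) (hn' : u (n + 1) = a + 1) :
    m = n := by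
  rcases lt_trichotomy m n with h | h | h
  · have := hu (Nat.succ_le_of_lt h); simp only [Nat.succ_eq_add_one] at this; omega
  · exact h
  · have := hu (Nat.succ_le_of_lt h); simp only [Nat.succ_eq_add_one] at this; omega

lemma bounded_of_not_tendsto {u : ℕ → ℕ} (hu : Monotone u) (h : ¬ Tendsto u atTop atTop) :
    ∃ m, ∀ n, u n ≤ m := by
  by_contra! hcon
  exact h (tendsto_atTop_atTop_of_monotone hu fun b => (hcon b).imp fun _ hn => hn.le)

lemma eventually_const_of_not_tendsto {u : ℕ → ℕ} (hu : Monotone u)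
    (h : ¬ Tendsto u atTop atTop) : ∃ m N, ∀ n, N ≤ n → u n = m := by
  rcases tendsto_atTop_of_monotone hu with h' | ⟨l, hl⟩
  · exact absurd h' h
  · rw [nhds_discrete, tendsto_pure] at hl
    exact ⟨l, eventually_atTop.mp hl⟩

end Paths

lemma tsum_ofReal_tail_eq_top {g : ℕ → ℝ} (hg : ∀ b, 1 ≤ b → 0 < g b)
    (hs : ¬ Summable fun n : ℕ => 1 / g (n + 1)) (N : ℕ) :
    ∑' n : ℕ, ENNReal.ofReal (1 / g (n + N + 1)) = ⊤ := by
  by_contra hne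
  refine hs ((summable_nat_add_iff N).mp ?_)
  refine (ENNReal.summable_toReal hne).congr fun n => ?_
  exact ENNReal.toReal_ofReal (one_div_pos.mpr (hg _ (by omega))).le

/-! ### Pairs of counters: estimates from counting crossings -/

section Measure

variable {Ω : Type*} [MeasurableSpace Ω] {μ : Measure Ω}

lemma measure_iUnion_of_ae_unique {E : ℕ → Set Ω} (hE : ∀ n, MeasurableSet (E n))
    (hu : ∀ᵐ ω ∂μ, ∀ m n, ω ∈ E m → ω ∈ E n → m = n) :
    μ (⋃ n, E n) = ∑' n, μ (E n) := by
  refine measure_iUnion₀ (fun m n hmn => ?_) fun n => (hE n).nullMeasurableSet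
  refine measure_mono_null (t := {ω | ¬ ∀ m n, ω ∈ E m → ω ∈ E n → m = n}) ?_ hu
  intro ω hω h
  exact hmn (h m n hω.1 hω.2)

/-- Two monotone counters that jump by one, never simultaneously, and whose chances of jumping
from a state `(a, b)` with `a, b ≥ 1` are in proportion `f a : g b`. -/
structure IsPairUrn (μ : Measure Ω) (f g : ℕ → ℝ) (X Y : ℕ → Ω → ℕ) : Prop where
  f_pos : ∀ a, 1 ≤ a → 0 < f a
  g_pos : ∀ b, 1 ≤ b → 0 < g b
  measurable_X : ∀ n, Measurable (X n)
  measurable_Y : ∀ n, Measurable (Y n)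
  le : ∀ᵐ ω ∂μ, ∀ n, X n ω ≤ n + 1 ∧ Y n ω ≤ n + 1
  step : ∀ᵐ ω ∂μ, ∀ n, (X (n + 1) ω = X n ω ∧ Y (n + 1) ω = Y n ω) ∨
    (X (n + 1) ω = X n ω + 1 ∧ Y (n + 1) ω = Y n ω) ∨
    (X (n + 1) ω = X n ω ∧ Y (n + 1) ω = Y n ω + 1)
  balance : ∀ n a b, 1 ≤ a → 1 ≤ b →
    g b * μ.real {ω | X n ω = a ∧ Y n ω = b ∧ X (n + 1) ω = a + 1} =
      f a * μ.real {ω | X n ω = a ∧ Y n ω = b ∧ Y (n + 1) ω = b + 1}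

/-- The event that `X` jumps from `a` to `a + 1` while `Y` is at `b`. -/
def crossing (X Y : ℕ → Ω → ℕ) (a b : ℕ) : Set Ω :=
  ⋃ n, {ω | X n ω = a ∧ Y n ω = b ∧ X (n + 1) ω = a + 1}

omit [MeasurableSpace Ω] in
lemma mem_crossing {X Y : ℕ → Ω → ℕ} {a b : ℕ} {ω : Ω} :
    ω ∈ crossing X Y a b ↔ ∃ n, X n ω = a ∧ Y n ω = b ∧ X (n + 1) ω = a + 1 := by
  simp [crossing]

namespace IsPairUrn

variable {f g : ℕ → ℝ} {X Y : ℕ → Ω → ℕ}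

lemma symm (h : IsPairUrn μ f g X Y) : IsPairUrn μ g f Y X where
  f_pos := h.g_pos
  g_pos := h.f_pos
  measurable_X := h.measurable_Y
  measurable_Y := h.measurable_X
  le := h.le.mono fun _ hω n => (hω n).symm
  step := h.step.mono fun _ hω n => by
    rcases hω n with h | h | h
    · exact Or.inl h.symm
    · exact Or.inr (Or.inr h.symm)
    · exact Or.inr (Or.inl h.symm)
  balance n a b ha hb := by
    have := h.balance n b a hb ha
    simp only [and_left_comm (a := Y n _ = a)]
    exact this.symm

lemma unit_steps (h : IsPairUrn μ f g X Y) :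
    ∀ᵐ ω ∂μ, ∀ n, X (n + 1) ω = X n ω ∨ X (n + 1) ω = X n ω + 1 :=
  h.step.mono fun _ hω n => by
    rcases hω n with h | h | h
    · exact Or.inl h.1
    · exact Or.inr h.1
    · exact Or.inl h.1

lemma ae_monotone (h : IsPairUrn μ f g X Y) : ∀ᵐ ω ∂μ, Monotone fun n => X n ω :=
  h.unit_steps.mono fun _ hω => monotone_of_unit_steps hω

lemma measurableSet_jump (h : IsPairUrn μ f g X Y) (n a b : ℕ) :
    MeasurableSet {ω | X n ω = a ∧ Y n ω = b ∧ X (n + 1) ω = a + 1} :=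
  (h.measurable_X n (measurableSet_singleton a)).inter
    ((h.measurable_Y n (measurableSet_singleton b)).inter
      (h.measurable_X (n + 1) (measurableSet_singleton (a + 1))))

lemma measurableSet_crossing (h : IsPairUrn μ f g X Y) (a b : ℕ) :
    MeasurableSet (crossing X Y a b) :=
  MeasurableSet.iUnion fun n => h.measurableSet_jump n a b

lemma measure_crossing (h : IsPairUrn μ f g X Y) (a b : ℕ) :
    μ (crossing X Y a b) = ∑' n, μ {ω | X n ω = a ∧ Y n ω = b ∧ X (n + 1) ω = a + 1} := by
  refine measure_iUnion_of_ae_unique (fun n => h.measurableSet_jump n a b) ?_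
  filter_upwards [h.ae_monotone] with ω hω m n hm hn
  exact crossing_time_unique hω hm.1 hm.2.2 hn.1 hn.2.2

/-- The one-time balance divided by `f a * g b` and summed over time; the jump events at distinct
times are almost surely disjoint. -/
lemma crossing_balance [IsFiniteMeasure μ] (h : IsPairUrn μ f g X Y) {a b : ℕ}
    (ha : 1 ≤ a) (hb : 1 ≤ b) :
    ENNReal.ofReal (1 / f a) * μ (crossing X Y a b) =
      ENNReal.ofReal (1 / g b) * μ (crossing Y X b a) := by
  rw [h.measure_crossing, h.symm.measure_crossing, ← ENNReal.tsum_mul_left,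
    ← ENNReal.tsum_mul_left]
  congr 1 with n
  have hf := h.f_pos a ha
  have hg := h.g_pos b hb
  have key := h.balance n a b ha hb
  simp only [and_left_comm (a := Y n _ = b)]
  rw [← ofReal_measureReal, ← ofReal_measureReal, ← ENNReal.ofReal_mul (by positivity),
    ← ENNReal.ofReal_mul (by positivity)]
  congr 1
  field_simp
  linarith

/-- `X` leaves level `a` at most once, so at most one value of `Y` is seen at that moment. -/
lemma tsum_measure_crossing_le [IsProbabilityMeasure μ] (h : IsPairUrn μ f g X Y) (a : ℕ) :
    ∑' b, μ (crossing X Y a b) ≤ 1 := by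
  rw [← measure_iUnion_of_ae_unique (fun b => h.measurableSet_crossing a b)]
  · exact prob_le_one
  · filter_upwards [h.ae_monotone] with ω hω b b' hb hb'
    obtain ⟨m, hm⟩ := mem_crossing.mp hb
    obtain ⟨n, hn⟩ := mem_crossing.mp hb'
    have := crossing_time_unique hω hm.1 hm.2.2 hn.1 hn.2.2
    subst this
    exact hm.2.1.symm.trans hn.2.1

/-- If the reciprocals of `f` are not summable, `X` cannot grow while `Y` is stuck. -/
theorem tendsto_of_not_summable [IsProbabilityMeasure μ] (h : IsPairUrn μ f g X Y)
    (hs : ¬ Summable fun n : ℕ => 1 / f (n + 1)) :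
    ∀ᵐ ω ∂μ, Tendsto (fun n => X n ω) atTop atTop → (∃ n, 1 ≤ Y n ω) →
      Tendsto (fun n => Y n ω) atTop atTop := by
  have hnull : ∀ b N, 1 ≤ b → μ (⋂ n, crossing X Y (n + N + 1) b) = 0 := by
    intro b N hb
    by_contra hne
    set E := ⋂ n, crossing X Y (n + N + 1) b
    have hg : ENNReal.ofReal (1 / g b) ≠ ⊤ := ENNReal.ofReal_ne_top
    -- On `E`, `X` crosses every level above `N` with `Y` at `b`. Balance turns these crossings into
    -- exits of `Y` from `b`, of total mass at most one, although the weights `1 / f` diverge.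
    have h1 : ∑' n : ℕ, ENNReal.ofReal (1 / f (n + N + 1)) * μ E ≤ ENNReal.ofReal (1 / g b) * 1 :=
      calc ∑' n : ℕ, ENNReal.ofReal (1 / f (n + N + 1)) * μ E
          ≤ ∑' n : ℕ, ENNReal.ofReal (1 / g b) * μ (crossing Y X b (n + N + 1)) := by
            refine ENNReal.tsum_le_tsum fun n => ?_
            rw [← h.crossing_balance (by omega) hb]
            gcongr
            exact Set.iInter_subset _ n
        _ = ENNReal.ofReal (1 / g b) * ∑' n : ℕ, μ (crossing Y X b (n + (N + 1))) :=
            ENNReal.tsum_mul_left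
        _ ≤ ENNReal.ofReal (1 / g b) * 1 := by
            gcongr
            refine le_trans ?_ (h.symm.tsum_measure_crossing_le b)
            exact ENNReal.tsum_comp_le_tsum_of_injective (add_left_injective (N + 1)) _
    rw [ENNReal.tsum_mul_right, tsum_ofReal_tail_eq_top h.f_pos hs, ENNReal.top_mul hne,
      mul_one, top_le_iff] at h1
    exact hg h1
  have hnull' : ∀ᵐ ω ∂μ, ∀ b N, 1 ≤ b → ω ∉ ⋂ n, crossing X Y (n + N + 1) b := by
    refine ae_all_iff.mpr fun b => ae_all_iff.mpr fun N => ?_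
    by_cases hb : 1 ≤ b
    · filter_upwards [measure_eq_zero_iff_ae_notMem.mp (hnull b N hb)] with ω hω _ using hω
    · exact ae_of_all _ fun _ h => absurd h hb
  filter_upwards [hnull', h.unit_steps, h.symm.ae_monotone] with ω hω hX hY hXlim ⟨n₀, hn₀⟩
  by_contra hnot
  obtain ⟨b, N, hb⟩ := eventually_const_of_not_tendsto hY hnot
  have hb1 : 1 ≤ b := by
    have h1 : Y n₀ ω ≤ Y (max n₀ N) ω := hY (le_max_left _ _)
    rw [hb _ (le_max_right _ _)] at h1
    exact hn₀.trans h1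
  -- Levels above `X N ω` are crossed after time `N`, when `Y` is already frozen at `b`.
  refine hω b (X N ω) hb1 (Set.mem_iInter.mpr fun n => ?_)
  obtain ⟨k, hk, hk', hk''⟩ := exists_crossing_time hX hXlim (m := N) (a := n + X N ω + 1) (by omega)
  exact mem_crossing.mpr ⟨k, hk', hb k hk, hk''⟩

/-- If the reciprocals of `f` are summable and those of `g` are not, then `X` and `Y` cannot both
grow to infinity. -/
theorem not_both_tendsto_of_not_summable [IsProbabilityMeasure μ] (h : IsPairUrn μ f g X Y)
    (hf : Summable fun n : ℕ => 1 / f (n + 1)) (hg : ¬ Summable fun n : ℕ => 1 / g (n + 1)) :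
    ∀ᵐ ω ∂μ, Tendsto (fun n => X n ω) atTop atTop →
      ¬ Tendsto (fun n => Y n ω) atTop atTop := by
  have hfin : ∑' b : ℕ, ∑' a : ℕ,
      ENNReal.ofReal (1 / g (b + 1)) * μ (crossing Y X (b + 1) (a + 1)) ≠ ⊤ := by
    have hle : ∑' b : ℕ, ∑' a : ℕ,
        ENNReal.ofReal (1 / g (b + 1)) * μ (crossing Y X (b + 1) (a + 1)) ≤
          ∑' a : ℕ, ENNReal.ofReal (1 / f (a + 1)) := by
      -- With `a` fixed, balance replaces the weights `1 / g` by the single weight `1 / f`, and the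
      -- crossings out of `a` have total mass at most one.
      rw [ENNReal.tsum_comm]
      refine ENNReal.tsum_le_tsum fun a => ?_
      simp_rw [← h.crossing_balance (Nat.le_add_left 1 a) (Nat.le_add_left 1 _)]
      rw [ENNReal.tsum_mul_left]
      refine mul_le_of_le_one_right' ?_
      refine le_trans ?_ (h.tsum_measure_crossing_le (a + 1))
      exact ENNReal.tsum_comp_le_tsum_of_injective (add_left_injective 1) _
    exact ne_top_of_le_ne_top hf.tsum_ofReal_ne_top hle
  have hnull : ∀ N, μ (⋂ b : ℕ, ⋃ a : ℕ, crossing Y X (b + N + 1) (a + 1)) = 0 := by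
    intro N
    by_contra hne
    set E := ⋂ b : ℕ, ⋃ a : ℕ, crossing Y X (b + N + 1) (a + 1)
    refine hfin (top_le_iff.mp ?_)
    calc (⊤ : ENNReal) = ∑' b : ℕ, ENNReal.ofReal (1 / g (b + N + 1)) * μ E := by
          rw [ENNReal.tsum_mul_right, tsum_ofReal_tail_eq_top h.g_pos hg, ENNReal.top_mul hne]
      _ ≤ ∑' b : ℕ, ∑' a : ℕ,
          ENNReal.ofReal (1 / g (b + N + 1)) * μ (crossing Y X (b + N + 1) (a + 1)) := by
          refine ENNReal.tsum_le_tsum fun b => ?_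
          rw [ENNReal.tsum_mul_left]
          gcongr
          exact (measure_mono (Set.iInter_subset _ b)).trans (measure_iUnion_le _)
      _ ≤ _ := ENNReal.tsum_comp_le_tsum_of_injective (add_left_injective N)
          (fun b => ∑' a : ℕ,
            ENNReal.ofReal (1 / g (b + 1)) * μ (crossing Y X (b + 1) (a + 1)))
  have hnull' := ae_all_iff.mpr fun N => measure_eq_zero_iff_ae_notMem.mp (hnull N)
  filter_upwards [hnull', h.ae_monotone, h.symm.unit_steps] with ω hω hX hY hXlim hYlim
  obtain ⟨m, hm⟩ := (hXlim.eventually_ge_atTop 1).exists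
  -- Starting from a time `m` with `X` positive keeps every later crossing of `Y` within the range
  -- where balance holds.
  refine hω (Y m ω) (Set.mem_iInter.mpr fun b => Set.mem_iUnion.mpr ?_)
  obtain ⟨k, hk, hk', hk''⟩ := exists_crossing_time hY hYlim (m := m) (a := b + Y m ω + 1) (by omega)
  have : 1 ≤ X k ω := hm.trans (hX hk)
  exact ⟨X k ω - 1, mem_crossing.mpr ⟨k, hk', by omega, hk''⟩⟩

end IsPairUrn

end Measure

/-! ### Characteristic functions of the remaining explosion times -/

/-- A normalized infinite product of the factors `1 + i θ / f n`. -/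
lemma exists_damped_product {f : ℕ → ℝ} (hf : ∀ a, 1 ≤ a → 0 < f a)
    (hs : Summable fun n : ℕ => 1 / f (n + 1)) (θ : ℝ) :
    ∃ u : ℕ → ℂ, (∀ a, u (a + 1) = u a * (1 + (θ / f a : ℝ) * Complex.I)) ∧
      (∀ a, ‖u a‖ ≤ 1) ∧ (∀ a, 1 ≤ a → ‖u a‖ * |θ| ≤ f a) ∧ Tendsto u atTop (nhds 1) := by
  set w : ℕ → ℂ := fun n => (θ / f n : ℝ) * Complex.I with hw
  have hre : ∀ n, (1 + w n).re = 1 := fun n => by simp [hw]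
  have him : ∀ n, (1 + w n).im = θ / f n := fun n => by simp [hw]
  have hone : ∀ n, 1 ≤ ‖1 + w n‖ := fun n => by
    have := Complex.abs_re_le_norm (1 + w n)
    rwa [hre, abs_one] at this
  have hsum : Summable fun n => ‖w n‖ := by
    refine (summable_nat_add_iff 1).mp ((hs.mul_left |θ|).congr fun n => ?_)
    simp [hw, abs_of_pos (hf (n + 1) (by omega)), div_eq_mul_inv]
  set x : ℕ → ℂ := fun a => ∏ n ∈ Finset.range a, (1 + w n) with hx
  have hxs : ∀ a, x (a + 1) = x a * (1 + w a) := fun a => Finset.prod_range_succ _ _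
  obtain ⟨l, hl⟩ : ∃ l, Tendsto x atTop (nhds l) :=
    ⟨_, (multipliable_one_add_of_summable hsum).hasProd.tendsto_prod_nat⟩
  have hmono : Monotone fun a => ‖x a‖ := monotone_nat_of_le_succ fun a => by
    rw [hxs, norm_mul]
    exact le_mul_of_one_le_right (norm_nonneg _) (hone a)
  have hle : ∀ a, ‖x a‖ ≤ ‖l‖ := fun a => hmono.ge_of_tendsto hl.norm a
  -- The norms increase from `‖x 0‖ = 1`, so one may divide by the limit.
  have hl1 : 1 ≤ ‖l‖ := by simpa [hx] using hle 0
  have hl0 : l ≠ 0 := fun h => by norm_num [h] at hl1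
  have hu1 : ∀ a, ‖x a / l‖ ≤ 1 := fun a => by
    rw [norm_div]
    exact div_le_one_of_le₀ (hle a) (norm_nonneg _)
  refine ⟨fun a => x a / l, fun a => ?_, hu1, fun a ha => ?_, ?_⟩
  · simp only [hxs, hw]
    ring
  -- Decay in `θ`: the next value still has norm at most `1`, while the factor leading to it has
  -- norm at least `|θ| / f a`.
  · have h1 := hu1 (a + 1)
    have h2 := Complex.abs_im_le_norm (1 + w a)
    rw [him, abs_div, abs_of_pos (hf a ha), div_le_iff₀ (hf a ha)] at h2
    have h3 : x (a + 1) / l = x a / l * (1 + w a) := by rw [hxs]; ring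
    rw [h3, norm_mul] at h1
    calc ‖x a / l‖ * |θ| ≤ ‖x a / l‖ * (‖1 + w a‖ * f a) := by gcongr
      _ = ‖x a / l‖ * ‖1 + w a‖ * f a := by ring
      _ ≤ 1 * f a := by have := (hf a ha).le; gcongr
      _ = f a := one_mul _
  · simpa [hl0] using hl.div_const l

lemma sum_range_ite_sub {R : ℕ → Prop} [DecidablePred R] (hR : ∀ m n, m ≤ n → R m → R n)
    {τ : ℕ} (hτ : R τ) (hlt : ∀ n < τ, ¬ R n) (H : ℕ → ℂ) (N : ℕ) :
    ∑ n ∈ Finset.range N, (if R n then H (n + 1) - H n else 0) =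
      if τ ≤ N then H N - H τ else 0 := by
  induction N with
  | zero =>
    by_cases h : τ ≤ 0
    · simp [Nat.le_zero.mp h]
    · simp [h]
  | succ N ih =>
    rw [Finset.sum_range_succ, ih]
    by_cases h : τ ≤ N
    · simp [h, Nat.le_succ_of_le h, hR τ N h hτ]
    · rcases Nat.lt_or_ge (N + 1) τ with h' | h'
      · simp [h, hlt N (by omega), not_le.mpr h']
      · obtain rfl : τ = N + 1 := by omega
        simp [hlt N (by omega)]

lemma tendsto_zero_of_norm_mul_le {z : ℕ → ℂ} {C : ℝ} (h : ∀ k, ‖z k‖ * k ≤ C) :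
    Tendsto z atTop (nhds 0) := by
  refine squeeze_zero_norm' ?_ (tendsto_const_div_atTop_nhds_zero_nat C)
  filter_upwards [eventually_gt_atTop 0] with k hk
  rw [le_div_iff₀ (by exact_mod_cast hk)]
  exact h k

/-- Along a monotone path the damped products converge, to `1` if the path is unbounded, and
otherwise to something that vanishes as the frequency grows. -/
lemma exists_limit_along_path {f : ℕ → ℝ} {u : ℕ → ℕ → ℂ}
    (hu : ∀ k a, 1 ≤ a → ‖u k a‖ * k ≤ f a) (hlim : ∀ k, Tendsto (u k) atTop (nhds 1))
    {x : ℕ → ℕ} (hx : Monotone x) {τ : ℕ} (hτ : 1 ≤ x τ) :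
    ∃ l : ℕ → ℂ, (∀ k, Tendsto (fun n => u k (x n)) atTop (nhds (l k))) ∧
      ((Tendsto x atTop atTop ∧ l = 1) ∨
        (¬ Tendsto x atTop atTop ∧ Tendsto l atTop (nhds 0))) := by
  by_cases h : Tendsto x atTop atTop
  · exact ⟨1, fun k => (hlim k).comp h, Or.inl ⟨h, rfl⟩⟩
  · obtain ⟨m, N, hm⟩ := eventually_const_of_not_tendsto hx h
    have hm1 : 1 ≤ m := by
      have := hx (le_max_left τ N)
      rw [hm _ (le_max_right _ _)] at this
      exact hτ.trans this
    refine ⟨fun k => u k m, fun k => ?_, Or.inr ⟨h, ?_⟩⟩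
    · refine tendsto_const_nhds.congr' ?_
      filter_upwards [eventually_ge_atTop N] with n hn
      rw [hm n hn]
    · exact tendsto_zero_of_norm_mul_le (C := f m) fun k => hu k m hm1

/-! ### Harmonic functions of the pair and simultaneous growth -/

section Measure

variable {Ω : Type*} [MeasurableSpace Ω] {μ : Measure Ω}

namespace IsPairUrn

variable {f g : ℕ → ℝ} {X Y : ℕ → Ω → ℕ}

/-- The increment of `H (X, Y)`, counted only from the time when both `X` and `Y` are positive. -/
noncomputable def increment (X Y : ℕ → Ω → ℕ) (H : ℕ → ℕ → ℂ) (n : ℕ) (ω : Ω) : ℂ :=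
  if 1 ≤ X n ω ∧ 1 ≤ Y n ω then
    H (X (n + 1) ω) (Y (n + 1) ω) - H (X n ω) (Y n ω) else 0

lemma measurable_increment (h : IsPairUrn μ f g X Y) (H : ℕ → ℕ → ℂ) (n : ℕ) :
    Measurable (increment X Y H n) := by
  have hH : ∀ m, Measurable fun ω => H (X m ω) (Y m ω) := fun m =>
    (measurable_of_countable (Function.uncurry H)).comp
      ((h.measurable_X m).prodMk (h.measurable_Y m))
  refine Measurable.ite ?_ ((hH (n + 1)).sub (hH n)) measurable_const
  exact (measurableSet_le measurable_const (h.measurable_X n)).inter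
    (measurableSet_le measurable_const (h.measurable_Y n))

/-- The increment is split over the finitely many states `(a, b)` possible at time `n`; on each,
balance and harmonicity cancel the two jumps. Only the current state enters, so no conditioning on
the past is needed. -/
lemma integral_increment [IsFiniteMeasure μ] (h : IsPairUrn μ f g X Y) {H : ℕ → ℕ → ℂ}
    (hH : ∀ a b, 1 ≤ a → 1 ≤ b →
      f a * (H (a + 1) b - H a b) + g b * (H a (b + 1) - H a b) = 0) (n : ℕ) :
    ∫ ω, increment X Y H n ω ∂μ = 0 := by
  set SX : ℕ → ℕ → Set Ω := fun a b => {ω | X n ω = a ∧ Y n ω = b ∧ X (n + 1) ω = a + 1}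
  set SY : ℕ → ℕ → Set Ω := fun a b => {ω | X n ω = a ∧ Y n ω = b ∧ Y (n + 1) ω = b + 1}
  have mSX : ∀ a b, MeasurableSet (SX a b) := fun a b => h.measurableSet_jump n a b
  have mSY : ∀ a b, MeasurableSet (SY a b) := fun a b => by
    have := h.symm.measurableSet_jump n b a
    simp only [and_left_comm (a := Y n _ = b)] at this
    exact this
  have hexp : increment X Y H n =ᵐ[μ] fun ω =>
      ∑ a ∈ Finset.Icc 1 (n + 1), ∑ b ∈ Finset.Icc 1 (n + 1),
        ((SX a b).indicator (fun _ => H (a + 1) b - H a b) ω +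
          (SY a b).indicator (fun _ => H a (b + 1) - H a b) ω) := by
    filter_upwards [h.le, h.step] with ω hle hstep
    have hle := hle n
    have hterm : ∀ a b, 1 ≤ a → 1 ≤ b → (SX a b).indicator (fun _ => H (a + 1) b - H a b) ω +
        (SY a b).indicator (fun _ => H a (b + 1) - H a b) ω =
          if Y n ω = b then if X n ω = a then increment X Y H n ω else 0 else 0 := by
      intro a b ha1 hb1
      by_cases hb : Y n ω = b
      · by_cases ha : X n ω = a
        · subst ha hb
          rcases hstep n with h' | h' | h' <;>
            simp [SX, SY, increment, ha1, hb1, h'.1, h'.2]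
        · simp [SX, SY, ha]
      · simp [SX, SY, hb]
    rw [Finset.sum_congr rfl fun a ha => Finset.sum_congr rfl fun b hb =>
      hterm a b (Finset.mem_Icc.mp ha).1 (Finset.mem_Icc.mp hb).1]
    simp only [Finset.sum_ite_eq]
    by_cases hY : 1 ≤ Y n ω
    · by_cases hX : 1 ≤ X n ω
      · simp [hX, hY, hle.1, hle.2]
      · simp [hX, increment]
    · simp [hY, increment]
  have hint : ∀ (S : Set Ω) (c : ℂ), MeasurableSet S →
      Integrable (S.indicator fun _ => c) μ := fun S c hS => (integrable_const c).indicator hS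
  have hint' : ∀ a b, Integrable (fun ω => (SX a b).indicator (fun _ => H (a + 1) b - H a b) ω +
      (SY a b).indicator (fun _ => H a (b + 1) - H a b) ω) μ := fun a b =>
    (hint _ _ (mSX a b)).add (hint _ _ (mSY a b))
  rw [integral_congr_ae hexp, integral_finsetSum _ fun a _ =>
    integrable_finsetSum _ fun b _ => hint' a b]
  refine Finset.sum_eq_zero fun a ha => ?_
  rw [integral_finsetSum _ fun b _ => hint' a b]
  refine Finset.sum_eq_zero fun b hb => ?_
  have ha1 := (Finset.mem_Icc.mp ha).1
  have hb1 := (Finset.mem_Icc.mp hb).1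
  rw [integral_add (hint _ _ (mSX a b)) (hint _ _ (mSY a b)), integral_indicator_const _ (mSX a b),
    integral_indicator_const _ (mSY a b), Complex.real_smul, Complex.real_smul]
  have hbal : (g b : ℂ) * μ.real (SX a b) = f a * μ.real (SY a b) := by
    exact_mod_cast h.balance n a b ha1 hb1
  have hf : (f a : ℂ) ≠ 0 := by exact_mod_cast (h.f_pos a ha1).ne'
  -- After multiplication by `f a`, balance trades `f a` for `g b` in the `Y`-jump term, and
  -- harmonicity applies.
  refine (mul_eq_zero.mp ?_).resolve_left hf
  linear_combination (μ.real (SX a b) : ℂ) * hH a b ha1 hb1 - (H a (b + 1) - H a b) * hbal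

/-- If the reciprocals of `f` and of `g` are summable, then `X` and `Y` cannot both grow to
infinity. -/
theorem not_both_tendsto_of_summable [IsProbabilityMeasure μ] (h : IsPairUrn μ f g X Y)
    (hf : Summable fun n : ℕ => 1 / f (n + 1)) (hg : Summable fun n : ℕ => 1 / g (n + 1)) :
    ∀ᵐ ω ∂μ, Tendsto (fun n => X n ω) atTop atTop →
      ¬ Tendsto (fun n => Y n ω) atTop atTop := by
  choose u hus hu1 huk hulim using fun k : ℕ => exists_damped_product h.f_pos hf (k : ℝ)
  -- Opposite frequencies: the `X`- and `Y`-drifts of `u k a * v k b` are `±i k` times the function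
  -- itself and cancel.
  choose v hvs hv1 hvk hvlim using fun k : ℕ => exists_damped_product h.g_pos hg (-(k : ℝ))
  simp only [abs_neg, Nat.abs_cast] at huk hvk
  set H : ℕ → ℕ → ℕ → ℂ := fun k a b => u k a * v k b
  have hH1 : ∀ k a b, ‖H k a b‖ ≤ 1 := fun k a b => by
    rw [norm_mul]
    exact mul_le_one₀ (hu1 k a) (norm_nonneg _) (hv1 k b)
  have hharm : ∀ k a b, 1 ≤ a → 1 ≤ b →
      f a * (H k (a + 1) b - H k a b) + g b * (H k a (b + 1) - H k a b) = 0 := by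
    intro k a b ha hb
    have hfa : (f a : ℂ) ≠ 0 := by exact_mod_cast (h.f_pos a ha).ne'
    have hgb : (g b : ℂ) ≠ 0 := by exact_mod_cast (h.g_pos b hb).ne'
    simp only [H, hus, hvs]
    push_cast
    field_simp
    ring
  set S : ℕ → ℕ → Ω → ℂ := fun k N ω => ∑ n ∈ Finset.range N, increment X Y (H k) n ω
  set D : Set Ω := {ω | Tendsto (fun n => X n ω) atTop atTop} ∩
    {ω | Tendsto (fun n => Y n ω) atTop atTop}
  have hD : MeasurableSet D :=
    (measurableSet_tendsto _ h.measurable_X).inter (measurableSet_tendsto _ h.measurable_Y)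
  -- The sum telescopes from the first time both counters are positive. The starting value vanishes
  -- as `k → ∞`; the limiting value is `1` on `D` and otherwise vanishes as well, since a stuck
  -- counter keeps a fixed positive state.
  have hpath : ∀ᵐ ω ∂μ, (∀ k N, ‖S k N ω‖ ≤ 2) ∧ ∃ z : ℕ → ℂ,
      (∀ k, Tendsto (fun N => S k N ω) atTop (nhds (z k))) ∧
        Tendsto z atTop (nhds (D.indicator 1 ω)) := by
    filter_upwards [h.ae_monotone, h.symm.ae_monotone] with ω hX hY
    by_cases hex : ∃ n, 1 ≤ X n ω ∧ 1 ≤ Y n ω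
    · have hτ := Nat.find_spec hex
      have hlt := fun n => Nat.find_min hex (m := n)
      set τ := Nat.find hex
      have hS : ∀ k N, S k N ω =
          if τ ≤ N then H k (X N ω) (Y N ω) - H k (X τ ω) (Y τ ω) else 0 := fun k N =>
        sum_range_ite_sub (R := fun n => 1 ≤ X n ω ∧ 1 ≤ Y n ω)
          (fun m n hmn hm => ⟨hm.1.trans (hX hmn), hm.2.trans (hY hmn)⟩) hτ hlt
          (fun n => H k (X n ω) (Y n ω)) N
      refine ⟨fun k N => ?_, ?_⟩
      · rw [hS]
        split_ifs
        · refine (norm_sub_le _ _).trans ?_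
          linarith [hH1 k (X N ω) (Y N ω), hH1 k (X τ ω) (Y τ ω)]
        · simp
      obtain ⟨l, hl, hl'⟩ := exists_limit_along_path huk hulim hX hτ.1
      obtain ⟨m, hm, hm'⟩ := exists_limit_along_path hvk hvlim hY hτ.2
      refine ⟨fun k => l k * m k - H k (X τ ω) (Y τ ω), fun k => ?_, ?_⟩
      · refine (((hl k).mul (hm k)).sub_const _).congr' ?_
        filter_upwards [eventually_ge_atTop τ] with N hN
        rw [hS, if_pos hN]
      · have hstart : Tendsto (fun k => H k (X τ ω) (Y τ ω)) atTop (nhds 0) := by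
          refine tendsto_zero_of_norm_mul_le (C := f (X τ ω)) fun k => ?_
          refine le_trans ?_ (huk k _ hτ.1)
          rw [norm_mul]
          gcongr
          exact mul_le_of_le_one_right (norm_nonneg _) (hv1 k _)
        have hnorm : ∀ (w : ℕ → ℕ → ℂ) (x : ℕ → ℕ) (l : ℕ → ℂ), (∀ k a, ‖w k a‖ ≤ 1) →
            (∀ k, Tendsto (fun n => w k (x n)) atTop (nhds (l k))) → ∀ k, ‖l k‖ ≤ 1 :=
          fun w x l hw hl k => le_of_tendsto' (hl k).norm fun n => hw k _
        have hbl := hnorm u _ l hu1 hl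
        have hbm := hnorm v _ m hv1 hm
        rcases hl' with ⟨hXlim, rfl⟩ | ⟨hXlim, hl0⟩
        · rcases hm' with ⟨hYlim, rfl⟩ | ⟨hYlim, hm0⟩
          · have : ω ∈ D := ⟨hXlim, hYlim⟩
            simpa [this] using hstart.const_sub 1
          · have : ω ∉ D := fun hω => hYlim hω.2
            simpa [this] using hm0.sub hstart
        · have : ω ∉ D := fun hω => hXlim hω.1
          have hlm : Tendsto (fun k => l k * m k) atTop (nhds 0) := by
            refine squeeze_zero_norm (fun k => ?_) (tendsto_zero_iff_norm_tendsto_zero.mp hl0)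
            rw [norm_mul]
            exact mul_le_of_le_one_right (norm_nonneg _) (hbm k)
          simpa [this] using hlm.sub hstart
    · have hS : ∀ k N, S k N ω = 0 := fun k N =>
        Finset.sum_eq_zero fun n _ => if_neg fun hn => hex ⟨n, hn⟩
      have hωD : ω ∉ D := fun hω => by
        obtain ⟨n, hn⟩ := ((hω.1.eventually_ge_atTop 1).and (hω.2.eventually_ge_atTop 1)).exists
        exact hex ⟨n, hn⟩
      exact ⟨fun k N => by simp [hS], fun _ => 0, fun k => by simp [hS],
        by rw [Set.indicator_of_notMem hωD]; exact tendsto_const_nhds⟩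
  have hSm : ∀ k N, AEStronglyMeasurable (S k N) μ := fun k N =>
    (Finset.measurable_sum _ fun n _ => h.measurable_increment (H k) n).aestronglyMeasurable
  -- The limits `z` were chosen separately for each outcome; `Z` packages them as functions to
  -- integrate.
  set Z : ℕ → Ω → ℂ := fun k ω => limUnder atTop fun N => S k N ω
  have hZ : ∀ k, ∀ᵐ ω ∂μ, Tendsto (fun N => S k N ω) atTop (nhds (Z k ω)) := fun k => by
    filter_upwards [hpath] with ω ⟨_, z, hz, _⟩
    exact tendsto_nhds_limUnder ⟨_, hz k⟩
  have hS0 : ∀ k N, ∫ ω, S k N ω ∂μ = 0 := fun k N => by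
    rw [integral_finsetSum]
    · exact Finset.sum_eq_zero fun n _ => h.integral_increment (hharm k) n
    · refine fun n _ => Integrable.of_bound
        (h.measurable_increment (H k) n).aestronglyMeasurable 2 (ae_of_all _ fun ω => ?_)
      unfold increment
      split_ifs
      · refine (norm_sub_le _ _).trans ?_
        linarith [hH1 k (X (n + 1) ω) (Y (n + 1) ω), hH1 k (X n ω) (Y n ω)]
      · simp
  have hZ0 : ∀ k, ∫ ω, Z k ω ∂μ = 0 := fun k => by
    have := tendsto_integral_of_dominated_convergence (fun _ => (2 : ℝ)) (hSm k)
      (integrable_const _) (fun N => hpath.mono fun ω hω => hω.1 k N) (hZ k)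
    simp only [hS0] at this
    exact tendsto_nhds_unique this tendsto_const_nhds |>.symm ▸ rfl
  have hlim : Tendsto (fun k => ∫ ω, Z k ω ∂μ) atTop (nhds (∫ ω, D.indicator 1 ω ∂μ)) := by
    refine tendsto_integral_of_dominated_convergence (fun _ => (2 : ℝ))
      (fun k => aestronglyMeasurable_of_tendsto_ae atTop (hSm k) (hZ k)) (integrable_const _)
      (fun k => ?_) ?_
    · filter_upwards [hpath, hZ k] with ω hω hz
      exact le_of_tendsto' hz.norm fun N => hω.1 k N
    · filter_upwards [hpath] with ω ⟨_, z, hz, hz'⟩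
      exact hz'.congr fun k => (hz k).limUnder_eq.symm
  simp only [hZ0] at hlim
  have hD0 : μ D = 0 := by
    have h0 := tendsto_nhds_unique hlim tendsto_const_nhds
    rw [Pi.one_def, integral_indicator_const _ hD, Complex.real_smul, mul_one,
      Complex.ofReal_eq_zero] at h0
    exact (measureReal_eq_zero_iff).mp h0
  filter_upwards [measure_eq_zero_iff_ae_notMem.mp hD0] with ω hω hX hY
  exact hω ⟨hX, hY⟩

theorem not_both_tendsto [IsProbabilityMeasure μ] (h : IsPairUrn μ f g X Y)
    (hf : Summable fun n : ℕ => 1 / f (n + 1)) :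
    ∀ᵐ ω ∂μ, Tendsto (fun n => X n ω) atTop atTop →
      ¬ Tendsto (fun n => Y n ω) atTop atTop := by
  by_cases hg : Summable fun n : ℕ => 1 / g (n + 1)
  · exact h.not_both_tendsto_of_summable hf hg
  · exact h.not_both_tendsto_of_not_summable hf hg

end IsPairUrn

end Measure

/-! ### From the attachment model to pairs of counters -/

section Model

variable {Ω : Type*} {A : ℕ → ℕ → Ω → ℕ} {ω : Ω}

/-- The pathwise part of the definition of a generalized attachment model. -/
structure IsPath (A : ℕ → ℕ → Ω → ℕ) (ω : Ω) : Prop where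
  init : A 1 1 ω = 1 ∧ ∀ j, 2 ≤ j → A j 1 ω = 0
  step : ∀ n, 1 ≤ n → ∃ k, 1 ≤ k ∧ k ≤ numGroups A n ω + 1 ∧
    A k (n + 1) ω = A k n ω + 1 ∧ ∀ j, 1 ≤ j → j ≠ k → A j (n + 1) ω = A j n ω

namespace IsPath

lemma unit_steps (h : IsPath A ω) {j : ℕ} (hj : 1 ≤ j) (n : ℕ) :
    A j (n + 1 + 1) ω = A j (n + 1) ω ∨ A j (n + 1 + 1) ω = A j (n + 1) ω + 1 := by
  obtain ⟨k, -, -, hk, hk'⟩ := h.step (n + 1) (by omega)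
  by_cases hjk : j = k
  · subst hjk; exact Or.inr hk
  · exact Or.inl (hk' j hj hjk)

lemma monotone (h : IsPath A ω) {j : ℕ} (hj : 1 ≤ j) : Monotone fun n => A j (n + 1) ω :=
  monotone_of_unit_steps (h.unit_steps hj)

lemma le (h : IsPath A ω) {j : ℕ} (hj : 1 ≤ j) (n : ℕ) : A j (n + 1) ω ≤ n + 1 := by
  induction n with
  | zero =>
    rcases hj.eq_or_lt with rfl | hj'
    · exact h.init.1.le
    · simp [h.init.2 j hj']
  | succ n ih => rcases h.unit_steps hj n with h' | h' <;> omega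

lemma bddAbove (h : IsPath A ω) (n : ℕ) : BddAbove {j : ℕ | 1 ≤ j ∧ 1 ≤ A j (n + 1) ω} := by
  induction n with
  | zero =>
    refine ⟨1, fun j hj => ?_⟩
    by_contra! hlt
    have h1 := hj.2
    rw [h.init.2 j hlt] at h1
    omega
  | succ n ih =>
    obtain ⟨B, hB⟩ := ih
    obtain ⟨k, -, -, -, hk'⟩ := h.step (n + 1) (by omega)
    refine ⟨max B k, fun j hj => ?_⟩
    by_cases hjk : j = k
    · exact hjk.le.trans (le_max_right _ _)
    · have hj' := hj.2
      rw [hk' j hj.1 hjk] at hj'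
      exact (hB ⟨hj.1, hj'⟩).trans (le_max_left _ _)

lemma le_numGroups (h : IsPath A ω) {j : ℕ} (hj : 1 ≤ j) {n : ℕ} (hA : 1 ≤ A j (n + 1) ω) :
    j ≤ numGroups A (n + 1) ω :=
  le_csSup (h.bddAbove n) ⟨hj, hA⟩

lemma pair_step (h : IsPath A ω) {i j : ℕ} (hi : 1 ≤ i) (hj : 1 ≤ j) (hij : i ≠ j) (n : ℕ) :
    (A i (n + 1 + 1) ω = A i (n + 1) ω ∧ A j (n + 1 + 1) ω = A j (n + 1) ω) ∨
    (A i (n + 1 + 1) ω = A i (n + 1) ω + 1 ∧ A j (n + 1 + 1) ω = A j (n + 1) ω) ∨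
    (A i (n + 1 + 1) ω = A i (n + 1) ω ∧ A j (n + 1 + 1) ω = A j (n + 1) ω + 1) := by
  obtain ⟨k, -, -, hk, hk'⟩ := h.step (n + 1) (by omega)
  by_cases hik : i = k
  · subst hik; exact Or.inr (Or.inl ⟨hk, hk' j hj hij.symm⟩)
  · by_cases hjk : j = k
    · subst hjk; exact Or.inr (Or.inr ⟨hk' i hi hij, hk⟩)
    · exact Or.inl ⟨hk' i hi hik, hk' j hj hjk⟩

lemma created_iff {j : ℕ} (hj : 1 ≤ j) : Created A ω j ↔ ∃ n, 1 ≤ A j (n + 1) ω := by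
  constructor
  · rintro ⟨-, n, hn, hA⟩
    exact ⟨n - 1, by rwa [Nat.sub_add_cancel hn]⟩
  · rintro ⟨n, hA⟩
    exact ⟨hj, n + 1, by omega, hA⟩

lemma growsToInfinity_iff {j : ℕ} :
    GrowsToInfinity A ω j ↔ Tendsto (fun n => A j (n + 1) ω) atTop atTop :=
  (tendsto_add_atTop_iff_nat (f := fun n => A j n ω) 1).symm

lemma staysFinite (h : IsPath A ω) {j : ℕ} (hj : 1 ≤ j) (hg : ¬ GrowsToInfinity A ω j) :
    StaysFinite A ω j := by
  rw [growsToInfinity_iff] at hg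
  obtain ⟨m, hm⟩ := bounded_of_not_tendsto (h.monotone hj) hg
  exact ⟨m, fun n hn => by simpa [Nat.sub_add_cancel hn] using hm (n - 1)⟩

end IsPath

variable [MeasurableSpace Ω] {μ : Measure Ω} {f : ℕ → ℕ → ℝ} {s : ℕ → Ω → ℝ}

namespace IsGAM

lemma ae_isPath (hA : IsGAM μ f s A) : ∀ᵐ ω ∂μ, IsPath A ω := by
  have hstep := ae_all_iff.mpr fun n : ℕ => hA.step (n + 1) (by omega)
  filter_upwards [hA.init, hstep] with ω h₁ h₂
  refine ⟨h₁, fun n hn => ?_⟩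
  have := h₂ (n - 1)
  rwa [Nat.sub_add_cancel hn] at this

lemma stateSigma_le (hA : IsGAM μ f s A) {n : ℕ} (hn : 1 ≤ n) :
    stateSigma s A n ≤ ‹MeasurableSpace Ω› :=
  sup_le (iSup₂_le fun j hj => (hA.measurable_A j n hj hn).comap_le)
    (hA.measurable_s n hn).comap_le

omit [MeasurableSpace Ω] in
lemma measurableSet_stateSigma {j n : ℕ} (hj : 1 ≤ j) (a : ℕ) :
    MeasurableSet[stateSigma s A n] {ω | A j n ω = a} := by
  have hle : MeasurableSpace.comap (A j n) ⊤ ≤ stateSigma s A n :=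
    le_sup_of_le_left (le_iSup₂_of_le j hj le_rfl)
  exact hle _ ⟨{a}, trivial, rfl⟩

/-- The probability that the new member joins group `k`, on an event of the current state. -/
lemma measureReal_inter_join [IsProbabilityMeasure μ] (hA : IsGAM μ f s A) {k n : ℕ} (hk : 1 ≤ k)
    (hn : 1 ≤ n) {T : Set Ω} (hT : MeasurableSet[stateSigma s A n] T)
    (hTk : ∀ᵐ ω ∂μ, ω ∈ T → k ≤ numGroups A n ω) :
    μ.real (T ∩ {ω | A k (n + 1) ω = A k n ω + 1}) =
      ∫ ω in T, (1 - s n ω) * (f k (A k n ω) / totalWeight f A n ω) ∂μ := by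
  have hle := hA.stateSigma_le hn
  have hJ : MeasurableSet {ω | A k (n + 1) ω = A k n ω + 1} :=
    measurableSet_eq_fun (hA.measurable_A k (n + 1) hk (by omega))
      ((hA.measurable_A k n hk hn).add_const 1)
  have hcond := setIntegral_condExp hle
    ((integrable_const (1 : ℝ)).indicator (μ := μ) hJ) hT
  rw [setIntegral_indicator hJ, setIntegral_const, smul_eq_mul, mul_one] at hcond
  rw [← hcond]
  refine setIntegral_congr_ae (hle _ hT) ?_
  filter_upwards [hA.prob_join n k hn hk, hTk] with ω h₁ h₂ hω
  exact h₁ (h₂ hω)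

/-- Both joining probabilities are integrated over the same event of the current state, where the
sizes are constant, and share the integrand `(1 - s_n) / totalWeight`. Positivity of `a` and `b`
ensures that both groups are already present. -/
lemma balance [IsProbabilityMeasure μ] (hA : IsGAM μ f s A) {i j : ℕ} (hi : 1 ≤ i) (hj : 1 ≤ j)
    (n : ℕ) {a b : ℕ} (ha : 1 ≤ a) (hb : 1 ≤ b) :
    f j b * μ.real {ω | A i (n + 1) ω = a ∧ A j (n + 1) ω = b ∧ A i (n + 1 + 1) ω = a + 1} =
      f i a * μ.real {ω | A i (n + 1) ω = a ∧ A j (n + 1) ω = b ∧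
        A j (n + 1 + 1) ω = b + 1} := by
  set T : Set Ω := {ω | A i (n + 1) ω = a} ∩ {ω | A j (n + 1) ω = b}
  have hT : MeasurableSet[stateSigma s A (n + 1)] T :=
    MeasurableSet.inter (measurableSet_stateSigma hi a) (measurableSet_stateSigma hj b)
  have hTi : {ω | A i (n + 1) ω = a ∧ A j (n + 1) ω = b ∧ A i (n + 1 + 1) ω = a + 1} =
      T ∩ {ω | A i (n + 1 + 1) ω = A i (n + 1) ω + 1} := by
    ext ω
    simp only [T, Set.mem_ofPred_eq, Set.mem_inter_iff]
    constructor
    · rintro ⟨h1, h2, h3⟩; exact ⟨⟨h1, h2⟩, by omega⟩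
    · rintro ⟨⟨h1, h2⟩, h3⟩; exact ⟨h1, h2, by omega⟩
  have hTj : {ω | A i (n + 1) ω = a ∧ A j (n + 1) ω = b ∧ A j (n + 1 + 1) ω = b + 1} =
      T ∩ {ω | A j (n + 1 + 1) ω = A j (n + 1) ω + 1} := by
    ext ω
    simp only [T, Set.mem_ofPred_eq, Set.mem_inter_iff]
    constructor
    · rintro ⟨h1, h2, h3⟩; exact ⟨⟨h1, h2⟩, by omega⟩
    · rintro ⟨⟨h1, h2⟩, h3⟩; exact ⟨h1, h2, by omega⟩
  have hpath := hA.ae_isPath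
  rw [hTi, hTj, hA.measureReal_inter_join hi (by omega) hT, hA.measureReal_inter_join hj (by omega) hT,
    ← integral_const_mul, ← integral_const_mul]
  · refine setIntegral_congr_fun (hA.stateSigma_le (by omega) _ hT) fun ω hω => ?_
    have h1 : A i (n + 1) ω = a := hω.1
    have h2 : A j (n + 1) ω = b := hω.2
    simp only [h1, h2]
    ring
  · filter_upwards [hpath] with ω h hω
    exact h.le_numGroups hj (hb.trans_eq hω.2.symm)
  · filter_upwards [hpath] with ω h hω
    exact h.le_numGroups hi (ha.trans_eq hω.1.symm)

/-- The time shift reconciles model times, which start at `1`, with counters indexed from `0`. -/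
lemma isPairUrn [IsProbabilityMeasure μ] (hA : IsGAM μ f s A) {i j : ℕ} (hi : 1 ≤ i) (hj : 1 ≤ j)
    (hij : i ≠ j) :
    IsPairUrn μ (f i) (f j) (fun n => A i (n + 1)) (fun n => A j (n + 1)) where
  f_pos a ha := hA.f_pos i a hi ha
  g_pos b hb := hA.f_pos j b hj hb
  measurable_X n := hA.measurable_A i (n + 1) hi (by omega)
  measurable_Y n := hA.measurable_A j (n + 1) hj (by omega)
  le := hA.ae_isPath.mono fun _ h n => ⟨h.le hi n, h.le hj n⟩
  step := hA.ae_isPath.mono fun _ h n => h.pair_step hi hj hij n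
  balance n _ _ ha hb := hA.balance hi hj n ha hb

lemma ae_not_both_grow [IsProbabilityMeasure μ] (hA : IsGAM μ f s A) :
    ∀ᵐ ω ∂μ, ∀ i j, 1 ≤ i → 1 ≤ j → i ≠ j → (Summable fun n : ℕ => 1 / f i (n + 1)) →
      GrowsToInfinity A ω i → ¬ GrowsToInfinity A ω j := by
  simp only [ae_all_iff]
  intro i j hi hj hij hs
  simp only [IsPath.growsToInfinity_iff]
  exact (hA.isPairUrn hi hj hij).not_both_tendsto hs

lemma ae_grows_of_grows [IsProbabilityMeasure μ] (hA : IsGAM μ f s A) :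
    ∀ᵐ ω ∂μ, ∀ i j, 1 ≤ i → (¬ Summable fun n : ℕ => 1 / f i (n + 1)) →
      GrowsToInfinity A ω i → Created A ω j → GrowsToInfinity A ω j := by
  simp only [ae_all_iff]
  intro i j hi hs
  by_cases hj : 1 ≤ j
  · by_cases hij : i = j
    · subst hij
      exact ae_of_all _ fun _ h _ => h
    · simp only [IsPath.growsToInfinity_iff, IsPath.created_iff hj]
      exact (hA.isPairUrn hi hj hij).tendsto_of_not_summable hs
  · exact ae_of_all _ fun _ _ h => absurd h.1 hj

end IsGAM

end Model

end GAM

/-! ### The phases, outcome by outcome -/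

theorem theorem1p5 {Ω : Type*} [MeasurableSpace Ω] (μ : Measure Ω) [IsProbabilityMeasure μ]
    (f : ℕ → ℕ → ℝ) (s : ℕ → Ω → ℝ) (A : ℕ → ℕ → Ω → ℕ) (hA : GAM.IsGAM μ f s A)
    (p : ℝ) (hp : p < 1) (hs : ∀ n, 1 ≤ n → ∀ᵐ ω ∂μ, s n ω ≤ p) :
    -- (i) some created group has a summable reciprocal reinforcement function
    (∀ᵐ ω ∂μ, (∃ j, GAM.Created A ω j ∧ Summable fun n : ℕ => 1 / f j (n + 1)) →
      (∀ i j, GAM.Created A ω i → GAM.Created A ω j →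
        GAM.GrowsToInfinity A ω i → GAM.GrowsToInfinity A ω j → i = j) ∧
      (∀ j, GAM.Created A ω j → ¬ GAM.GrowsToInfinity A ω j → GAM.StaysFinite A ω j)) ∧
    -- (ii) no created group has a summable reciprocal reinforcement function
    (∀ᵐ ω ∂μ, (∀ j, GAM.Created A ω j → ¬ Summable fun n : ℕ => 1 / f j (n + 1)) →
      (∀ j, GAM.Created A ω j → GAM.GrowsToInfinity A ω j) ∨
      (∀ j, GAM.Created A ω j → GAM.StaysFinite A ω j)) ∧
    -- at most three phases
    (∀ᵐ ω ∂μ,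
      (∀ j, GAM.Created A ω j → GAM.GrowsToInfinity A ω j) ∨
      (∀ j, GAM.Created A ω j → GAM.StaysFinite A ω j) ∨
      (∃ i, GAM.Created A ω i ∧ GAM.GrowsToInfinity A ω i ∧
        ∀ j, GAM.Created A ω j → j ≠ i → GAM.StaysFinite A ω j)) := by
  have hcore : ∀ᵐ ω ∂μ,
      ((∃ j, GAM.Created A ω j ∧ Summable fun n : ℕ => 1 / f j (n + 1)) →
        (∀ i j, GAM.Created A ω i → GAM.Created A ω j →
          GAM.GrowsToInfinity A ω i → GAM.GrowsToInfinity A ω j → i = j)) ∧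
      ((∀ j, GAM.Created A ω j → ¬ Summable fun n : ℕ => 1 / f j (n + 1)) →
        (∀ j, GAM.Created A ω j → GAM.GrowsToInfinity A ω j) ∨
        (∀ j, GAM.Created A ω j → GAM.StaysFinite A ω j)) := by
    filter_upwards [hA.ae_isPath, hA.ae_not_both_grow, hA.ae_grows_of_grows] with ω hω hnot hgrow
    constructor
    · rintro ⟨k, hk, hks⟩
      have hsum : ∀ i, GAM.Created A ω i → GAM.GrowsToInfinity A ω i →
          Summable fun n : ℕ => 1 / f i (n + 1) := by
        intro i hi hgi
        -- A growing group with divergent series would force group `k` to grow too, but a growing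
        -- group with convergent series tolerates no other.
        by_contra hns
        have hki : k ≠ i := by rintro rfl; exact hns hks
        exact hnot k i hk.1 hi.1 hki hks (hgrow i k hi.1 hns hgi hk) hgi
      intro i j hi hj hgi hgj
      by_contra hij
      exact hnot i j hi.1 hj.1 hij (hsum i hi hgi) hgi hgj
    · intro hns
      by_cases hex : ∃ i, GAM.Created A ω i ∧ GAM.GrowsToInfinity A ω i
      · obtain ⟨i, hi, hgi⟩ := hex
        exact Or.inl fun j hj => hgrow i j hi.1 (hns i hi) hgi hj
      · exact Or.inr fun j hj => hω.staysFinite hj.1 fun hgj => hex ⟨j, hj, hgj⟩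
  refine ⟨?_, hcore.mono fun ω h => h.2, ?_⟩
  · filter_upwards [hA.ae_isPath, hcore] with ω hω h hex
    exact ⟨h.1 hex, fun j hj hgj => hω.staysFinite hj.1 hgj⟩
  · filter_upwards [hA.ae_isPath, hcore] with ω hω h
    by_cases hex : ∃ j, GAM.Created A ω j ∧ Summable fun n : ℕ => 1 / f j (n + 1)
    · by_cases hgex : ∃ i, GAM.Created A ω i ∧ GAM.GrowsToInfinity A ω i
      · obtain ⟨i, hi, hgi⟩ := hgex
        exact Or.inr (Or.inr ⟨i, hi, hgi, fun j hj hji =>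
          hω.staysFinite hj.1 fun hgj => hji (h.1 hex j i hj hi hgj hgi)⟩)
      · exact Or.inr (Or.inl fun j hj => hω.staysFinite hj.1 fun hgj => hgex ⟨j, hj, hgj⟩)
    · exact (h.2 fun j hj hjs => hex ⟨j, hj, hjs⟩).imp_right Or.inl
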